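/- Let $(\Xi,\mathcal G,P)$ be a probability space, and let $\xi_1,\xi_2,\dots$ be i.i.d. random elements of $\Xi$ with law $P$, defined on an arbitrary probability space $(\Omega,\mathcal F,\mathbb P)$. Write $\mathbb P_n=\frac1n\sum_{i=1}^n\delta_{\xi_i}$ for the empirical measure and $Qh=\int h\,dQ$. Let $\mathcal H$ be a class of $\mathcal G$-measurable functions $h:\Xi\to\mathbb R$ such that - $\mathcal H$ is a VC-subgraph class, that is, the collection of strict subgraphs $\{(x,t)\in\Xi\times\mathbb R:h(x)>t\}$, $h\in\mathcal H$, has finite VC dimension; - $\mathcal H$ has a measurable envelope $H:\Xi\to[0,\infty]$, meaning $|h(x)|\le H(x)$ for all $h\in\mathcal H$ and $x\in\Xi$, with $\int H^2\,dP<\infty$; - $\mathcal H$ is a $P$-measurable class, that is, for every $n\in\mathbb N$ and $e\in\mathbb R^n$ the map $(x_1,\dots,x_n)\mapsto\sup_{h\in\mathcal H}\bigl|\sum_{i=1}^n e_ih(x_i)\bigr|$ from $\Xi^n$ to $[0,\infty]$ is measurable for the $P^n$-completion of the product $\sigma$-algebra $\mathcal G^n$. Then $$\mathbb E^*\sup_{h\in\mathcal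 H}\bigl|(\mathbb P_n-P)h\bigr|=O(n^{-1/2})\qquad(n\to\infty),$$ and the left-hand side is finite for every $n\ge1$. Here, for a possibly nonmeasurable map $U:\Omega\to[-\infty,\infty]$, the outer expectation $\mathbb E^*U$ is the infimum of $\mathbb E[V]$ over all measurable $V:\Omega\to[-\infty,\infty]$ with $V\ge U$ for which $\mathbb E[V]$ exists in $[-\infty,\infty]$. The suprema are taken in $[0,\infty]$, so they are $0$ if $\mathcal H$ is empty. -/

import Mathlib

open MeasureTheory ProbabilityTheory Filter Asymptotics
open scoped ENNReal

noncomputable section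

namespace EmpiricalProcess

/-! ### Outer expectation -/

section Outer

variable {Ω : Type*} [MeasurableSpace Ω]

/-- The expectation `E[V] = E[V⁺] - E[V⁻]` of an extended-real-valued function exists when `E[V⁺]`
and `E[V⁻]` are not both infinite. -/
def ExpectationExists (μ : Measure Ω) (V : Ω → EReal) : Prop :=
  ∫⁻ ω, (V ω).toENNReal ∂μ ≠ ⊤ ∨ ∫⁻ ω, (-V ω).toENNReal ∂μ ≠ ⊤

/-- The expectation `E[V] = E[V⁺] - E[V⁻]`, with values in the extended reals. It is meaningful
when `V` is measurable and `ExpectationExists μ V`. -/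
def expectation (μ : Measure Ω) (V : Ω → EReal) : EReal :=
  ((∫⁻ ω, (V ω).toENNReal ∂μ : ℝ≥0∞) : EReal) - ((∫⁻ ω, (-V ω).toENNReal ∂μ : ℝ≥0∞) : EReal)

/-- The outer expectation `E*[U]` of an arbitrary (possibly nonmeasurable) map `U`: the infimum of
`E[V]` over all measurable `V ≥ U` whose expectation exists. -/
def outerExpectation (μ : Measure Ω) (U : Ω → EReal) : EReal :=
  sInf {e : EReal | ∃ V : Ω → EReal,
    Measurable V ∧ (∀ ω, U ω ≤ V ω) ∧ ExpectationExists μ V ∧ e = expectation μ V}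

end Outer

/-! ### VC-subgraph classes -/

section VC

variable {α : Type*}

/-- The collection `𝒞` shatters the finite set `s`: every subset of `s` has the form `s ∩ C` with
`C ∈ 𝒞`. -/
def Shatters (𝒞 : Set (Set α)) (s : Finset α) : Prop :=
  ∀ t : Set α, t ⊆ (s : Set α) → ∃ C ∈ 𝒞, (s : Set α) ∩ C = t

/-- The VC dimension of a collection of sets: the supremum of the cardinalities of the finite sets
that it shatters. -/
def vcDim (𝒞 : Set (Set α)) : ℕ∞ :=
  ⨆ (s : Finset α) (_ : Shatters 𝒞 s), (s.card : ℕ∞)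

/-- The strict subgraph `{(x, t) : h x > t}` of a real function. -/
def strictSubgraph (h : α → ℝ) : Set (α × ℝ) := {p | h p.1 > p.2}

/-- `ℋ` is a VC-subgraph class: the collection of strict subgraphs of its members has finite VC
dimension. -/
def IsVCSubgraph (ℋ : Set (α → ℝ)) : Prop := vcDim (strictSubgraph '' ℋ) < ⊤

end VC

/-! ### Empirical measures, `P`-measurable classes, envelopes -/

section Empirical

variable {Ξ : Type*} [MeasurableSpace Ξ]

/-- The empirical measure `n⁻¹ (δ_{x 0} + ⋯ + δ_{x (n - 1)})` of the first `n` points of a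
sequence. -/
def empiricalMeasure (x : ℕ → Ξ) (n : ℕ) : Measure Ξ :=
  (n : ℝ≥0∞)⁻¹ • ∑ i ∈ Finset.range n, Measure.dirac (x i)

/-- The integral of a measurable function against the empirical measure is the sample average. -/
theorem integral_empiricalMeasure (x : ℕ → Ξ) (n : ℕ) {h : Ξ → ℝ} (hh : Measurable h) :
    ∫ y, h y ∂(empiricalMeasure x n) = (n : ℝ)⁻¹ * ∑ i ∈ Finset.range n, h (x i) := by
  unfold empiricalMeasure
  rw [integral_smul_measure, integral_finsetSum_measure]
  · simp [integral_dirac' _ _ hh.stronglyMeasurable]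
  · intro i _
    exact integrable_dirac' hh.stronglyMeasurable (by simp)

/-- `ℋ` is a `P`-measurable class: for all `n` and `e ∈ ℝⁿ` the map
`(x₁, …, xₙ) ↦ sup_{h ∈ ℋ} |∑ eᵢ h(xᵢ)|`, with values in `[0, ∞]`, is measurable for the completion
of the product measure `Pⁿ`. -/
def IsPMeasurableClass (P : Measure Ξ) (ℋ : Set (Ξ → ℝ)) : Prop :=
  ∀ (n : ℕ) (e : Fin n → ℝ),
    NullMeasurable (fun x : Fin n → Ξ => ⨆ h ∈ ℋ, ENNReal.ofReal |∑ i, e i * h (x i)|)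
      (Measure.pi fun _ : Fin n => P)

/-- `H` is an envelope of `ℋ`: `|h| ≤ H` for every `h ∈ ℋ`. The value `∞` is allowed. -/
def IsEnvelope (ℋ : Set (Ξ → ℝ)) (H : Ξ → ℝ≥0∞) : Prop :=
  ∀ h ∈ ℋ, ∀ x, ENNReal.ofReal |h x| ≤ H x

/-- The uniform deviation `sup_{h ∈ ℋ} |(ℙₙ - P) h|`, with values in `[0, ∞]`; it is `0` for the
empty class. -/
def uniformDeviation (P : Measure Ξ) (ℋ : Set (Ξ → ℝ)) (x : ℕ → Ξ) (n : ℕ) : ℝ≥0∞ :=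
  ⨆ h ∈ ℋ, ENNReal.ofReal |∫ y, h y ∂(empiricalMeasure x n) - ∫ y, h y ∂P|

end Empirical

end EmpiricalProcess

end

/-! Symmetrization reduces the claim to Rademacher sums over fixed points, where chaining applies
because VC-subgraph classes have nets whose size does not depend on the sample.

A second sample of size n replaces P by a sample average. Exchanging the two copies of a coordinate
preserves the product law, so signs may be inserted and averaged: up to a factor 2, it suffices to
bound the mean of sup |∑ εᵢ h(xᵢ)| (`exists_measurable_ge_sum_sub`,
`pow_mul_lintegral_supWeightedSum_le`).

For fixed points put wᵢ = H(xᵢ) and S = ∑ wᵢ². Rademacher sums are sub-Gaussian for the Euclidean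
norm, so chaining through nets of mesh √S / 2 ^ k costs a multiple of √S once the square root of the
log of the net size grows at most linearly in k (`exists_majorant_of_nets`).

Such nets come from the VC dimension V. If m functions are δ-separated, a suitably random point (xᵢ,
t) lies between two given graphs with probability at least δ. Hence O(log m / δ) points tell all of
them apart, and Sauer–Shelah gives m ≤ (2 log m / δ + 2) ^ V, which makes m polynomial in 1 / δ
(`card_le_log_pow`, `le_pow_of_le_log_pow`).

Finally 2√S ≤ S / s + s is linear in S. Integrating it with s = √n gives order √n (∫ H² dP + 1), and
division by n gives the rate. -/

noncomputable section

namespace EmpiricalProcess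

/-! ### Rademacher sums -/

section Rademacher

variable {ι : Type*} [Fintype ι]

/-- The real sign encoded by a Boolean. -/
def boolSign (b : Bool) : ℝ := if b then 1 else -1

theorem abs_boolSign (b : Bool) : |boolSign b| = 1 := by
  cases b <;> simp [boolSign]

/-- The signed sum `∑ εᵢ aᵢ`. -/
def rademacherSum (ε : ι → Bool) (a : ι → ℝ) : ℝ := ∑ i, boolSign (ε i) * a i

theorem rademacherSum_add (ε : ι → Bool) (a b : EuclideanSpace ℝ ι) :
    rademacherSum ε (a + b : EuclideanSpace ℝ ι) = rademacherSum ε a + rademacherSum ε b := by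
  simp [rademacherSum, mul_add, Finset.sum_add_distrib]

theorem abs_rademacherSum_le (ε : ι → Bool) (a : EuclideanSpace ℝ ι) :
    |rademacherSum ε a| ≤ Fintype.card ι * ‖a‖ := by
  calc |rademacherSum ε a| ≤ ∑ i, |boolSign (ε i) * a i| := Finset.abs_sum_le_sum_abs _ _
    _ ≤ ∑ _i : ι, ‖a‖ := by
        refine Finset.sum_le_sum fun i _ => ?_
        rw [abs_mul, abs_boolSign, one_mul]
        exact PiLp.norm_apply_le a i
    _ = Fintype.card ι * ‖a‖ := by simp

/-- The sub-Gaussian bound: the sum over signs factorizes over coordinates, and cosh u ≤ exp(u² / 2)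
in each. -/
theorem sum_exp_rademacherSum_le [DecidableEq ι] (c : ℝ) (a : EuclideanSpace ℝ ι) :
    ∑ ε : ι → Bool, Real.exp (c * rademacherSum ε a) ≤
      2 ^ Fintype.card ι * Real.exp (c ^ 2 * ‖a‖ ^ 2 / 2) := by
  calc ∑ ε : ι → Bool, Real.exp (c * rademacherSum ε a)
      = ∑ ε : ι → Bool, ∏ i, Real.exp (c * (boolSign (ε i) * a i)) := by
        simp only [rademacherSum, Finset.mul_sum, Real.exp_sum]
    _ = ∏ i, ∑ b : Bool, Real.exp (c * (boolSign b * a i)) := by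
        rw [Finset.prod_univ_sum, Fintype.piFinset_univ]
    _ ≤ ∏ i, 2 * Real.exp ((c * a i) ^ 2 / 2) := by
        refine Finset.prod_le_prod (fun i _ => by positivity) fun i _ => ?_
        have h := Real.cosh_le_exp_half_sq (c * a i)
        rw [Real.cosh_eq] at h
        simp only [Fintype.sum_bool, boolSign, if_true, Bool.false_eq_true, if_false, one_mul,
          neg_mul, mul_neg]
        linarith
    _ = 2 ^ Fintype.card ι * Real.exp (c ^ 2 * ‖a‖ ^ 2 / 2) := by
        rw [Finset.prod_mul_distrib, Finset.prod_const, ← Real.exp_sum, EuclideanSpace.norm_sq_eq,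
          Finset.card_univ, Finset.mul_sum, Finset.sum_div]
        simp [mul_pow]

/-- The finite maximal inequality for Rademacher sums, with an explicit majorant in place of the
maximum. -/
theorem exists_majorant_of_card_le [DecidableEq ι] {α : Type*} (A : Finset α)
    (v : α → EuclideanSpace ℝ ι) {σ l : ℝ} (hσ : 0 < σ) (hl : 0 < l)
    (hv : ∀ a ∈ A, ‖v a‖ ≤ σ) (hA : 2 * (A.card : ℝ) ≤ Real.exp (l ^ 2)) :
    ∃ M : (ι → Bool) → ℝ, (∀ ε, ∀ a ∈ A, |rademacherSum ε (v a)| ≤ M ε) ∧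
      ∑ ε, M ε ≤ 2 ^ Fintype.card ι * (3 / 2 * l * σ) := by
  set c : ℝ := l / σ with hc
  have hc0 : 0 < c := by positivity
  -- L = l² + l² / 2: the first term pays for the 2 |A| exponentials, the second for the exponential
  -- moment.
  set L : ℝ := 3 / 2 * l ^ 2 with hL
  let S : (ι → Bool) → ℝ := fun ε => ∑ a ∈ A,
    (Real.exp (c * rademacherSum ε (v a)) + Real.exp (-c * rademacherSum ε (v a)))
  have hS : ∑ ε, S ε ≤ 2 ^ Fintype.card ι * Real.exp L := by
    calc ∑ ε, S ε = ∑ a ∈ A, (∑ ε, Real.exp (c * rademacherSum ε (v a)) +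
          ∑ ε, Real.exp (-c * rademacherSum ε (v a))) := by
          rw [Finset.sum_comm]; simp only [Finset.sum_add_distrib]
      _ ≤ ∑ a ∈ A, 2 * (2 ^ Fintype.card ι * Real.exp (l ^ 2 / 2)) := by
          refine Finset.sum_le_sum fun a ha => ?_
          have h1 := sum_exp_rademacherSum_le c (v a)
          have h2 := sum_exp_rademacherSum_le (-c) (v a)
          rw [neg_sq] at h2
          have h3 : c ^ 2 * ‖v a‖ ^ 2 / 2 ≤ l ^ 2 / 2 := by
            rw [← mul_pow]
            have : c * ‖v a‖ ≤ l := by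
              calc c * ‖v a‖ ≤ c * σ := by gcongr; exact hv a ha
                _ = l := by rw [hc]; field_simp
            gcongr
          have h4 : (2 : ℝ) ^ Fintype.card ι * Real.exp (c ^ 2 * ‖v a‖ ^ 2 / 2) ≤
            2 ^ Fintype.card ι * Real.exp (l ^ 2 / 2) := by gcongr
          linarith
      _ = 2 ^ Fintype.card ι * ((2 * A.card) * Real.exp (l ^ 2 / 2)) := by
          rw [Finset.sum_const, nsmul_eq_mul]; ring
      _ ≤ 2 ^ Fintype.card ι * (Real.exp (l ^ 2) * Real.exp (l ^ 2 / 2)) := by gcongr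
      _ = 2 ^ Fintype.card ι * Real.exp L := by rw [← Real.exp_add, hL]; ring_nf
  -- The tangent to log at exp L lies above log S and is affine in S, so averaging it replaces
  -- Jensen's inequality.
  refine ⟨fun ε => c⁻¹ * (Real.exp (-L) * S ε + (L - 1)), fun ε a ha => ?_, ?_⟩
  · rw [le_inv_mul_iff₀ hc0]
    have h1 : Real.exp (c * |rademacherSum ε (v a)|) ≤ S ε := by
      refine le_trans ?_ (Finset.single_le_sum (f := fun a =>
        Real.exp (c * rademacherSum ε (v a)) + Real.exp (-c * rademacherSum ε (v a)))
        (fun b _ => by positivity) ha)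
      have e1 := Real.exp_pos (c * rademacherSum ε (v a))
      have e2 := Real.exp_pos (-c * rademacherSum ε (v a))
      rcases abs_cases (rademacherSum ε (v a)) with ⟨h, _⟩ | ⟨h, _⟩ <;> rw [h]
      · simp only; linarith
      · rw [mul_neg, ← neg_mul]; simp only; linarith
    have h2 := Real.add_one_le_exp (-L + c * |rademacherSum ε (v a)|)
    rw [Real.exp_add] at h2
    have h3 := mul_le_mul_of_nonneg_left h1 (Real.exp_pos (-L)).le
    linarith
  · rw [← Finset.mul_sum, Finset.sum_add_distrib, ← Finset.mul_sum, inv_mul_le_iff₀ hc0]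
    have h1 := mul_le_mul_of_nonneg_left hS (Real.exp_pos (-L)).le
    have h2 : Real.exp (-L) * (2 ^ Fintype.card ι * Real.exp L) = 2 ^ Fintype.card ι := by
      rw [mul_left_comm, ← Real.exp_add]; simp
    have h3 : ∑ _ε : ι → Bool, (L - 1) = 2 ^ Fintype.card ι * (L - 1) := by simp [mul_sub]
    have h4 : c * (2 ^ Fintype.card ι * (3 / 2 * l * σ)) = 2 ^ Fintype.card ι * L := by
      rw [hc, hL]; field_simp
    rw [h3, h4]
    linarith

/-- Chaining along nets `A k` of mesh `D / 2 ^ k`. -/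
theorem exists_majorant_of_nets [DecidableEq ι] {T : Set (EuclideanSpace ℝ ι)}
    (A : ℕ → Finset (EuclideanSpace ℝ ι)) {D c : ℝ} (hD : 0 < D) (hc : 0 < c)
    (hA0 : A 0 = {0}) (hAT : ∀ k, ∀ a ∈ A (k + 1), a ∈ T)
    (hnet : ∀ k, ∀ t ∈ T, ∃ a ∈ A k, ‖t - a‖ ≤ D / 2 ^ k)
    (hcard : ∀ k, 2 * ((A (k + 1)).card : ℝ) ≤ Real.exp ((c * (k + 1)) ^ 2))
    {η : ℝ} (hη : 0 < η) :
    ∃ M : (ι → Bool) → ℝ, (∀ ε, ∀ t ∈ T, |rademacherSum ε t| ≤ M ε) ∧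
      ∑ ε, M ε ≤ 2 ^ Fintype.card ι * (6 * c * D + η) := by
  -- The last factor is the closed form of ∑ (k + 1) / 2 ^ k over k < K. It stays below 4, whence
  -- the constant 6.
  have key : ∀ K : ℕ, ∃ M : (ι → Bool) → ℝ,
      (∀ ε, ∀ a ∈ A K, |rademacherSum ε a| ≤ M ε) ∧
      ∑ ε, M ε ≤ 2 ^ Fintype.card ι * (3 / 2 * c * D * (4 - (K + 2) * 2 / 2 ^ K)) := by
    intro K
    induction K with
    | zero => exact ⟨fun _ => 0, by simp [hA0, rademacherSum], by norm_num⟩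
    | succ K ih =>
      obtain ⟨M, hM, hMs⟩ := ih
      have hp : ∀ a : EuclideanSpace ℝ ι, ∃ p, a ∈ A (K + 1) → p ∈ A K ∧ ‖a - p‖ ≤ D / 2 ^ K := by
        intro a
        by_cases ha : a ∈ A (K + 1)
        · obtain ⟨p, hp⟩ := hnet K a (hAT K a ha)
          exact ⟨p, fun _ => hp⟩
        · exact ⟨0, fun h => absurd h ha⟩
      choose p hp using hp
      obtain ⟨M', hM', hMs'⟩ := exists_majorant_of_card_le (A (K + 1)) (fun a => a - p a)
        (σ := D / 2 ^ K) (l := c * (K + 1)) (by positivity) (by positivity)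
        (fun a ha => (hp a ha).2) (hcard K)
      refine ⟨fun ε => M ε + M' ε, fun ε a ha => ?_, ?_⟩
      · have h1 := hM ε _ (hp a ha).1
        have h2 := hM' ε a ha
        have h3 := rademacherSum_add ε (p a) (a - p a)
        rw [add_sub_cancel] at h3
        rw [h3]
        exact (abs_add_le _ _).trans (add_le_add h1 h2)
      · rw [Finset.sum_add_distrib]
        refine (add_le_add hMs hMs').trans (le_of_eq ?_)
        push_cast
        field_simp
        ring
  -- The chain stops at a level where the trivial bound on the remaining link is at most η.
  obtain ⟨K, hK⟩ := exists_nat_gt (Fintype.card ι * D / η)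
  have hK' : Fintype.card ι * (D / 2 ^ K) ≤ η := by
    have h2 : (K : ℝ) < 2 ^ K := by exact_mod_cast Nat.lt_two_pow_self
    rw [div_lt_iff₀ hη] at hK
    rw [← mul_div_assoc, div_le_iff₀ (by positivity)]
    nlinarith
  obtain ⟨M, hM, hMs⟩ := key K
  refine ⟨fun ε => M ε + η, fun ε t ht => ?_, ?_⟩
  · obtain ⟨a, ha, hta⟩ := hnet K t ht
    have h1 := hM ε a ha
    have h3 := rademacherSum_add ε a (t - a)
    rw [add_sub_cancel] at h3
    rw [h3]
    refine (abs_add_le _ _).trans (add_le_add h1 ((abs_rademacherSum_le _ _).trans ?_))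
    refine le_trans ?_ hK'
    gcongr
  · rw [Finset.sum_add_distrib]
    have h1 : ∑ _ε : ι → Bool, η = 2 ^ Fintype.card ι * η := by simp
    rw [h1, mul_add]
    gcongr
    refine hMs.trans (mul_le_mul_of_nonneg_left ?_ (by positivity))
    have : 0 ≤ ((K : ℝ) + 2) * 2 / 2 ^ K := by positivity
    have hcD : 0 < c * D := by positivity
    linarith [mul_nonneg hcD.le this]

/-- A set whose finite separated subsets are bounded in size has a finite net. -/
theorem exists_net_of_card_le {E : Type*} [SeminormedAddCommGroup E] (T : Set E) (r : ℝ) (N : ℕ)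
    (h : ∀ A : Finset E, (∀ a ∈ A, a ∈ T) → (∀ a ∈ A, ∀ b ∈ A, a ≠ b → r < ‖a - b‖) →
      A.card ≤ N) :
    ∃ A : Finset E, (∀ a ∈ A, a ∈ T) ∧ (∀ a ∈ A, ∀ b ∈ A, a ≠ b → r < ‖a - b‖) ∧
      ∀ t ∈ T, ∃ a ∈ A, ‖t - a‖ ≤ r ∨ t = a := by
  classical
  let p : ℕ → Prop := fun m => ∃ A : Finset E, (∀ a ∈ A, a ∈ T) ∧
    (∀ a ∈ A, ∀ b ∈ A, a ≠ b → r < ‖a - b‖) ∧ A.card = m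
  have h0 : p 0 := ⟨∅, by simp, by simp, rfl⟩
  -- A separated set of largest size admits no further point, so it is a net. The alternative `t =
  -- a` matters only for negative r.
  obtain ⟨A, hAT, hsep, hcard⟩ : p (Nat.findGreatest p N) := Nat.findGreatest_spec (Nat.zero_le N) h0
  refine ⟨A, hAT, hsep, fun t ht => ?_⟩
  by_contra! hcon
  have htA : t ∉ A := fun htA => (hcon t htA).2 rfl
  have hins : p (A.card + 1) := by
    refine ⟨insert t A, ?_, ?_, Finset.card_insert_of_notMem htA⟩
    · simpa using ⟨ht, hAT⟩
    · intro a ha b hb hab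
      rw [Finset.mem_insert] at ha hb
      rcases ha with rfl | ha <;> rcases hb with rfl | hb
      · exact absurd rfl hab
      · exact (hcon b hb).1
      · rw [norm_sub_rev]; exact (hcon a ha).1
      · exact hsep a ha b hb hab
  have hle : A.card + 1 ≤ N := by
    obtain ⟨B, hB1, hB2, hB3⟩ := hins
    rw [← hB3]; exact h B hB1 hB2
  have := Nat.le_findGreatest hle hins
  omega

end Rademacher

/-! ### Packing numbers of VC-subgraph classes -/

section Packing

theorem card_le_of_isVCSubgraph {Ξ : Type*} {ℋ : Set (Ξ → ℝ)} (h : IsVCSubgraph ℋ) :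
    ∃ V : ℕ, ∀ s : Finset (Ξ × ℝ), Shatters (strictSubgraph '' ℋ) s → s.card ≤ V := by
  obtain ⟨V, hV⟩ := ENat.ne_top_iff_exists.1 (ne_of_lt h)
  refine ⟨V, fun s hs => ?_⟩
  have h1 : (s.card : ℕ∞) ≤ vcDim (strictSubgraph '' ℋ) :=
    le_iSup₂ (f := fun (s : Finset (Ξ × ℝ)) (_ : Shatters (strictSubgraph '' ℋ) s) =>
      (s.card : ℕ∞)) s hs
  rw [← hV] at h1
  exact_mod_cast h1

theorem sum_choose_le_pow (k V : ℕ) : ∑ j ∈ Finset.range (V + 1), k.choose j ≤ (k + 1) ^ V := by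
  rw [add_pow]
  refine Finset.sum_le_sum fun j hj => ?_
  rw [one_pow, mul_one, mul_comm]
  have h1 : 1 ≤ V.choose j := Nat.choose_pos (by simpa [Nat.lt_succ_iff] using hj)
  exact (Nat.choose_le_pow k j).trans (Nat.le_mul_of_pos_left _ h1)

/-- The Sauer–Shelah bound for the number of traces on a finite set. -/
theorem card_trace_le {α : Type*} [DecidableEq α] (𝒞 : Set (Set α)) (V : ℕ)
    (hV : ∀ s : Finset α, Shatters 𝒞 s → s.card ≤ V) (Z : Finset α) (𝒜 : Finset (Finset α))
    (h𝒜 : ∀ u ∈ 𝒜, ∃ C ∈ 𝒞, (u : Set α) = ↑Z ∩ C) :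
    𝒜.card ≤ (Z.card + 1) ^ V := by
  -- A finite family has at most as many members as it shatters sets. Here these are subsets of Z
  -- that 𝒞 shatters too, hence of size at most V.
  refine (Finset.card_le_card_shatterer 𝒜).trans (le_trans ?_ (sum_choose_le_pow Z.card V))
  have hsub : 𝒜.shatterer ⊆ (Finset.range (V + 1)).biUnion fun j => Z.powersetCard j := by
    intro s hs
    rw [Finset.mem_shatterer] at hs
    have hsZ : s ⊆ Z := by
      obtain ⟨u, hu, hsu⟩ := hs.exists_superset
      obtain ⟨C, -, hC⟩ := h𝒜 u hu
      refine hsu.trans fun x hx => ?_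
      have : x ∈ (u : Set α) := hx
      rw [hC] at this
      exact this.1
    have hcard : s.card ≤ V := by
      refine hV s fun t ht => ?_
      have htf : t.Finite := s.finite_toSet.subset ht
      obtain ⟨u, hu, hsu⟩ := hs (t := htf.toFinset) (by simpa [← Finset.coe_subset] using ht)
      obtain ⟨C, hC𝒞, hC⟩ := h𝒜 u hu
      refine ⟨C, hC𝒞, ?_⟩
      have h1 : ((s ∩ u : Finset α) : Set α) = t := by rw [hsu]; simp
      rw [← h1, Finset.coe_inter, hC, ← Set.inter_assoc,
        Set.inter_eq_left.2 (Finset.coe_subset.2 hsZ)]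
    simp only [Finset.mem_biUnion, Finset.mem_range, Finset.mem_powersetCard]
    exact ⟨s.card, by omega, hsZ, rfl⟩
  refine (Finset.card_le_card hsub).trans (Finset.card_biUnion_le.trans ?_)
  simp

/-- The point `z` lies in exactly one of the two strict subgraphs. -/
def Separates {Ξ : Type*} (z : Ξ × ℝ) (f g : Ξ → ℝ) : Prop := ¬(z.2 < f z.1 ↔ z.2 < g z.1)

/-- The separating levels form an interval of length |f x - g x|, which turns separation into a
measure. -/
theorem setOf_separates {Ξ : Type*} (x : Ξ) (f g : Ξ → ℝ) :
    {t : ℝ | Separates (x, t) f g} = Set.Ico (min (f x) (g x)) (max (f x) (g x)) := by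
  ext t
  simp only [Separates, Set.mem_ofPred_eq, Set.mem_Ico, min_le_iff, lt_max_iff]
  by_cases h1 : t < f x <;> by_cases h2 : t < g x <;> simp [h1, h2] <;> grind

variable {ι Ξ α : Type*} [Fintype ι]

open Classical in
/-- Some point separates at least the average proportion of the pairs. -/
theorem exists_separates (x : ι → Ξ) (w : ι → ℝ) (hw : ∀ i, 0 ≤ w i) (φ : α → Ξ → ℝ)
    (Q : Finset (α × α)) (hφ : ∀ q ∈ Q, ∀ i, |φ q.1 (x i)| ≤ w i ∧ |φ q.2 (x i)| ≤ w i)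
    {δ : ℝ} (hD : 0 < ∑ i, w i ^ 2)
    (hQ : ∀ q ∈ Q, δ * (2 * ∑ i, w i ^ 2) ≤ ∑ i, w i * |φ q.1 (x i) - φ q.2 (x i)|) :
    ∃ z : Ξ × ℝ, δ * Q.card ≤ ((Q.filter fun q => Separates z (φ q.1) (φ q.2)).card : ℝ) := by
  -- If i has probability proportional to wᵢ² and t is uniform on [-wᵢ, wᵢ), the hypothesis says
  -- that each pair is separated with probability at least δ. First i, then t is chosen to do at
  -- least as well as the average.
  obtain ⟨i, hi0, hi⟩ : ∃ i, 0 < w i ∧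
      δ * Q.card * (2 * w i) ≤ ∑ q ∈ Q, |φ q.1 (x i) - φ q.2 (x i)| := by
    by_contra! hcon
    obtain ⟨j, -, hj⟩ := Finset.exists_lt_of_sum_lt (s := Finset.univ) (f := fun _ => (0 : ℝ))
      (g := fun i => w i ^ 2) (by simpa using hD)
    have hj0 : 0 < w j := (hw j).lt_of_ne fun h => by simp [← h] at hj
    have h1 : ∑ i, w i * ∑ q ∈ Q, |φ q.1 (x i) - φ q.2 (x i)| <
        ∑ i, w i * (δ * Q.card * (2 * w i)) := by
      refine Finset.sum_lt_sum (fun i _ => ?_) ⟨j, Finset.mem_univ _, ?_⟩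
      · rcases (hw i).eq_or_lt with h | h
        · simp [← h]
        · exact mul_le_mul_of_nonneg_left (hcon i h).le h.le
      · exact mul_lt_mul_of_pos_left (hcon j hj0) hj0
    have h2 := Finset.sum_le_sum hQ
    rw [Finset.sum_comm] at h2
    simp only [← Finset.mul_sum, Finset.sum_const, nsmul_eq_mul] at h2
    have h3 : ∑ i, w i * (δ * Q.card * (2 * w i)) = Q.card * (δ * (2 * ∑ i, w i ^ 2)) := by
      simp only [Finset.mul_sum]
      exact Finset.sum_congr rfl fun i _ => by ring
    linarith
  let f : ℝ → ℝ := fun t => ∑ q ∈ Q, {t : ℝ | Separates (x i, t) (φ q.1) (φ q.2)}.indicator 1 t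
  have hmeas : ∀ q : α × α, MeasurableSet {t : ℝ | Separates (x i, t) (φ q.1) (φ q.2)} :=
    fun q => by rw [setOf_separates]; exact measurableSet_Ico
  have hint : ∀ q ∈ Q, IntegrableOn ({t : ℝ | Separates (x i, t) (φ q.1) (φ q.2)}.indicator 1)
      (Set.Ico (-w i) (w i)) (volume : Measure ℝ) := fun q _ =>
    IntegrableOn.indicator (f := (1 : ℝ → ℝ))
      (integrableOn_const (C := (1 : ℝ)) (by simp) (by simp)) (hmeas q)
  have hvol : (volume : Measure ℝ) (Set.Ico (-w i) (w i)) = ENNReal.ofReal (2 * w i) := by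
    rw [Real.volume_Ico]; ring_nf
  obtain ⟨t, -, ht⟩ := exists_setAverage_le (μ := (volume : Measure ℝ))
    (s := Set.Ico (-w i) (w i)) (f := f) (by rw [hvol]; simpa using hi0) (by simp)
    (integrable_finsetSum _ hint)
  refine ⟨(x i, t), ?_⟩
  have hft : f t = ((Q.filter fun q => Separates (x i, t) (φ q.1) (φ q.2)).card : ℝ) := by
    simp [f, Set.indicator_apply, Finset.sum_boole]
  rw [← hft]
  refine le_trans ?_ ht
  have hIf : ∫ t in Set.Ico (-w i) (w i), f t = ∑ q ∈ Q, |φ q.1 (x i) - φ q.2 (x i)| := by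
    rw [integral_finsetSum _ hint]
    refine Finset.sum_congr rfl fun q hq => ?_
    rw [integral_indicator_one (hmeas q), measureReal_restrict_apply (hmeas q), setOf_separates,
      Set.inter_eq_left.2]
    · rw [Real.volume_real_Ico_of_le (min_le_max), max_sub_min_eq_abs']
    · obtain ⟨h1, h2⟩ := hφ q hq i
      rw [abs_le] at h1 h2
      exact Set.Ico_subset_Ico (le_min h1.1 h2.1) (max_le h1.2 h2.2)
  rw [setAverage_eq, hIf, measureReal_def, hvol, ENNReal.toReal_ofReal (by positivity), smul_eq_mul,
    inv_mul_eq_div, le_div_iff₀ (by positivity)]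
  exact hi

open Classical in
/-- Greedy choice of `k` points leaves at most a proportion `(1 - δ) ^ k` of the pairs
unseparated. -/
theorem exists_card_not_separates_le (x : ι → Ξ) (w : ι → ℝ) (hw : ∀ i, 0 ≤ w i) (φ : α → Ξ → ℝ)
    (Q : Finset (α × α)) (hφ : ∀ q ∈ Q, ∀ i, |φ q.1 (x i)| ≤ w i ∧ |φ q.2 (x i)| ≤ w i)
    {δ : ℝ} (hδ : δ ≤ 1) (hD : 0 < ∑ i, w i ^ 2)
    (hQ : ∀ q ∈ Q, δ * (2 * ∑ i, w i ^ 2) ≤ ∑ i, w i * |φ q.1 (x i) - φ q.2 (x i)|) (k : ℕ) :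
    ∃ Z : Finset (Ξ × ℝ), Z.card ≤ k ∧
      ((Q.filter fun q => ∀ z ∈ Z, ¬Separates z (φ q.1) (φ q.2)).card : ℝ) ≤
        (1 - δ) ^ k * Q.card := by
  induction k with
  | zero => exact ⟨∅, by simp⟩
  | succ k ih =>
    obtain ⟨Z, hZ, hZQ⟩ := ih
    set R := Q.filter fun q => ∀ z ∈ Z, ¬Separates z (φ q.1) (φ q.2) with hR
    have hRQ : R ⊆ Q := Finset.filter_subset _ _
    obtain ⟨z, hz⟩ := exists_separates x w hw φ R (fun q hq => hφ q (hRQ hq)) hD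
      (fun q hq => hQ q (hRQ hq))
    refine ⟨insert z Z, (Finset.card_insert_le _ _).trans (by omega), ?_⟩
    have h1 : (Q.filter fun q => ∀ z' ∈ insert z Z, ¬Separates z' (φ q.1) (φ q.2)) =
        R.filter fun q => ¬Separates z (φ q.1) (φ q.2) := by
      ext q
      simp only [hR, Finset.mem_filter, Finset.forall_mem_insert]
      tauto
    have h2 := Finset.card_filter_add_card_filter_not (s := R)
      (fun q => Separates z (φ q.1) (φ q.2))
    have h3 : ((R.filter fun q => Separates z (φ q.1) (φ q.2)).card : ℝ) +
      (R.filter fun q => ¬Separates z (φ q.1) (φ q.2)).card = R.card := by exact_mod_cast h2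
    rw [h1, pow_succ]
    have h4 : (1 - δ) * R.card ≤ (1 - δ) * ((1 - δ) ^ k * Q.card) :=
      mul_le_mul_of_nonneg_left hZQ (by linarith)
    linarith

/-- The self-bounding packing inequality for VC-subgraph classes. -/
theorem card_le_log_pow {ℋ : Set (Ξ → ℝ)} {V : ℕ}
    (hV : ∀ s : Finset (Ξ × ℝ), Shatters (strictSubgraph '' ℋ) s → s.card ≤ V)
    (x : ι → Ξ) (w : ι → ℝ) (hw : ∀ i, 0 ≤ w i) (φ : α → Ξ → ℝ) (F : Finset α)
    (hF : ∀ a ∈ F, φ a ∈ ℋ) (hφ : ∀ a ∈ F, ∀ i, |φ a (x i)| ≤ w i)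
    {δ : ℝ} (hδ0 : 0 < δ) (hδ : δ ≤ 1) (hD : 0 < ∑ i, w i ^ 2)
    (hsep : ∀ a ∈ F, ∀ b ∈ F, a ≠ b →
      δ * (2 * ∑ i, w i ^ 2) ≤ ∑ i, w i * |φ a (x i) - φ b (x i)|) :
    (F.card : ℝ) ≤ (2 * Real.log F.card / δ + 2) ^ V := by
  classical
  rcases F.eq_empty_or_nonempty with rfl | hne
  · simp
  have hm : (1 : ℝ) ≤ F.card := by exact_mod_cast hne.card_pos
  have hlog : 0 ≤ Real.log F.card := Real.log_nonneg hm
  -- This k makes (1 - δ) ^ k |F|² < 1, so no pair is left unseparated.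
  set k : ℕ := ⌊2 * Real.log F.card / δ⌋₊ + 1 with hk
  obtain ⟨Z, hZ, hZQ⟩ := exists_card_not_separates_le x w hw φ F.offDiag
    (fun q hq i => by
      rw [Finset.mem_offDiag] at hq
      exact ⟨hφ _ hq.1 i, hφ _ hq.2.1 i⟩) hδ hD
    (fun q hq => by
      rw [Finset.mem_offDiag] at hq
      exact hsep _ hq.1 _ hq.2.1 hq.2.2) k
  have hlt : (1 - δ) ^ k * (F.offDiag.card : ℝ) < 1 := by
    have h1 : (F.offDiag.card : ℝ) ≤ F.card ^ 2 := by
      rw [Finset.offDiag_card, sq]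
      exact_mod_cast Nat.sub_le _ _
    have h2 : (1 - δ) ^ k ≤ Real.exp (-(δ * k)) := by
      have h3 := Real.add_one_le_exp (-δ)
      calc (1 - δ) ^ k ≤ Real.exp (-δ) ^ k := by gcongr; linarith
        _ = Real.exp (-(δ * k)) := by rw [← Real.exp_nat_mul]; ring_nf
    have h3 : 2 * Real.log F.card < δ * k := by
      have := Nat.lt_floor_add_one (2 * Real.log F.card / δ)
      rw [div_lt_iff₀ hδ0] at this
      rw [hk]; push_cast; linarith
    calc (1 - δ) ^ k * (F.offDiag.card : ℝ) ≤ Real.exp (-(δ * k)) * F.card ^ 2 := by gcongr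
      _ = Real.exp (-(δ * k)) * Real.exp (2 * Real.log F.card) := by
          rw [two_mul, Real.exp_add, Real.exp_log (by linarith), sq]
      _ < 1 := by rw [← Real.exp_add, Real.exp_lt_one_iff]; linarith
  have hempty : (F.offDiag.filter fun q => ∀ z ∈ Z, ¬Separates z (φ q.1) (φ q.2)) = ∅ := by
    rw [← Finset.card_eq_zero]
    have : ((F.offDiag.filter fun q => ∀ z ∈ Z, ¬Separates z (φ q.1) (φ q.2)).card : ℝ) < 1 :=
      lt_of_le_of_lt hZQ hlt
    exact Nat.lt_one_iff.1 (by exact_mod_cast this)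
  let tr : α → Finset (Ξ × ℝ) := fun a => Z.filter fun z => z.2 < φ a z.1
  have hinj : Set.InjOn tr F := by
    intro a ha b hb hab
    by_contra hne'
    have hmem : (a, b) ∉ F.offDiag.filter fun q => ∀ z ∈ Z, ¬Separates z (φ q.1) (φ q.2) := by
      rw [hempty]; simp
    refine hmem (Finset.mem_filter.2 ⟨Finset.mem_offDiag.2 ⟨ha, hb, hne'⟩, fun z hz => ?_⟩)
    have := congrArg (z ∈ ·) hab
    simp only [tr, Finset.mem_filter, hz, true_and, eq_iff_iff] at this
    simpa [Separates] using this
  have hcard : F.card ≤ (Z.card + 1) ^ V := by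
    rw [← Finset.card_image_of_injOn hinj]
    refine card_trace_le (strictSubgraph '' ℋ) V hV Z _ fun u hu => ?_
    obtain ⟨a, ha, rfl⟩ := Finset.mem_image.1 hu
    refine ⟨strictSubgraph (φ a), Set.mem_image_of_mem _ (hF a ha), ?_⟩
    ext z
    simp [tr, strictSubgraph]
  calc (F.card : ℝ) ≤ ((Z.card : ℝ) + 1) ^ V := by exact_mod_cast hcard
    _ ≤ (2 * Real.log F.card / δ + 2) ^ V := by
        have h1 : (Z.card : ℝ) ≤ k := by exact_mod_cast hZ
        have h2 : (k : ℝ) ≤ 2 * Real.log F.card / δ + 1 := by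
          rw [hk]; push_cast
          linarith [Nat.floor_le (show 0 ≤ 2 * Real.log F.card / δ by positivity)]
        exact pow_le_pow_left₀ (by positivity) (by linarith) V

/-- With y = m ^ (1 / 2V), log m ≤ 2 V y turns the hypothesis into y² ≤ y (4V + 2) / δ, and one
factor y cancels. -/
theorem le_pow_of_le_log_pow {m δ : ℝ} (V : ℕ) (hm : 1 ≤ m) (hδ0 : 0 < δ) (hδ : δ ≤ 1)
    (h : m ≤ (2 * Real.log m / δ + 2) ^ V) : m ≤ ((4 * V + 2) / δ) ^ (2 * V) := by
  rcases Nat.eq_zero_or_pos V with rfl | hV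
  · simpa using h
  have hV' : (0 : ℝ) < V := by exact_mod_cast hV
  set y : ℝ := m ^ ((2 * V : ℝ)⁻¹) with hy
  have hy1 : 1 ≤ y := Real.one_le_rpow hm (by positivity)
  have hym : m = y ^ (2 * V) := by
    rw [hy, ← Real.rpow_natCast, ← Real.rpow_mul (by linarith)]
    push_cast
    rw [inv_mul_cancel₀ (by positivity), Real.rpow_one]
  have hlog : Real.log m ≤ 2 * V * y := by
    rw [hym, Real.log_pow]
    push_cast
    gcongr
    linarith [Real.log_le_sub_one_of_pos (show 0 < y by linarith)]
  have h1 : y ^ 2 ≤ y * ((4 * V + 2) / δ) := by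
    have h2 : 2 * Real.log m / δ + 2 ≤ y * ((4 * V + 2) / δ) := by
      have h3 : 2 * Real.log m / δ ≤ 2 * (2 * V * y) / δ := by gcongr
      have h4 : 2 ≤ y * 2 / δ := by rw [le_div_iff₀ hδ0]; nlinarith
      calc 2 * Real.log m / δ + 2 ≤ 2 * (2 * V * y) / δ + y * 2 / δ := add_le_add h3 h4
        _ = _ := by ring
    have h0 : 0 ≤ 2 * Real.log m / δ + 2 := by have := Real.log_nonneg hm; positivity
    have h5 : (y ^ 2) ^ V ≤ (y * ((4 * V + 2) / δ)) ^ V := by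
      rw [← pow_mul, ← hym]
      exact h.trans (pow_le_pow_left₀ h0 h2 V)
    exact le_of_pow_le_pow_left₀ hV.ne' (by positivity) h5
  have h6 : y ≤ (4 * V + 2) / δ := by
    rw [sq] at h1
    exact le_of_mul_le_mul_left h1 (by linarith)
  calc m = y ^ (2 * V) := hym
    _ ≤ _ := by gcongr

/-- Log-cardinality is linear in k. Squaring the exponent is wasteful but matches the form required
for chaining. -/
theorem two_mul_le_exp_of_le_pow {m : ℝ} (V k : ℕ)
    (h : m ≤ ((4 * V + 2) / (1 / 4 ^ (k + 2))) ^ (2 * V)) :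
    2 * m ≤ Real.exp (((1 + 2 * V * (4 * V + 6)) * (k + 1)) ^ 2) := by
  have h1 : (4 * V + 2 : ℝ) ≤ Real.exp (4 * V + 2) := by
    linarith [Real.add_one_le_exp (4 * V + 2 : ℝ)]
  have h4 : (4 : ℝ) ≤ Real.exp 2 := by
    have := Real.add_one_le_exp (1 : ℝ)
    have h : Real.exp 2 = Real.exp 1 * Real.exp 1 := by rw [← Real.exp_add]; norm_num
    rw [h]; nlinarith
  have h5 : (4 * V + 2 : ℝ) / (1 / 4 ^ (k + 2)) ≤ Real.exp ((4 * V + 6) * (k + 1)) := by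
    rw [div_div_eq_mul_div, div_one]
    calc (4 * V + 2 : ℝ) * 4 ^ (k + 2) ≤ Real.exp (4 * V + 2) * Real.exp 2 ^ (k + 2) := by gcongr
      _ = Real.exp (4 * V + 2 + (k + 2) * 2) := by
          rw [← Real.exp_nat_mul, ← Real.exp_add]; push_cast; ring_nf
      _ ≤ _ := by
          gcongr
          have : (0 : ℝ) ≤ V * k := by positivity
          nlinarith
  have h2 : (2 : ℝ) ≤ Real.exp 1 := by linarith [Real.add_one_le_exp (1 : ℝ)]
  set c : ℝ := 1 + 2 * V * (4 * V + 6) with hc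
  have hc1 : 1 ≤ c := le_add_of_nonneg_right (by positivity)
  calc 2 * m ≤ Real.exp 1 * Real.exp ((4 * V + 6) * (k + 1)) ^ (2 * V) := by
        refine (mul_le_mul_of_nonneg_left (h.trans (pow_le_pow_left₀ (by positivity) h5 _))
          zero_le_two).trans ?_
        gcongr
    _ = Real.exp (1 + 2 * V * (4 * V + 6) * (k + 1)) := by
        rw [← Real.exp_nat_mul, ← Real.exp_add]; push_cast; ring_nf
    _ ≤ Real.exp (c * (k + 1)) := by
        gcongr
        rw [hc]
        have : (0 : ℝ) ≤ k := by positivity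
        linarith
    _ ≤ Real.exp ((c * (k + 1)) ^ 2) := by
        gcongr
        have : (1 : ℝ) ≤ c * (k + 1) := by
          have : (0 : ℝ) ≤ k := by positivity
          nlinarith
        nlinarith

end Packing

/-! ### Rademacher averages of VC-subgraph classes -/

section VCRademacher

variable {ι Ξ : Type*} [Fintype ι]

/-- Finite nets of the set of value vectors of a VC-subgraph class. -/
theorem exists_net_of_shatters_card_le {ℋ : Set (Ξ → ℝ)} {V : ℕ}
    (hV : ∀ s : Finset (Ξ × ℝ), Shatters (strictSubgraph '' ℋ) s → s.card ≤ V)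
    (x : ι → Ξ) (w : ι → ℝ) (hw : ∀ i, 0 ≤ w i) (hℋ : ∀ h ∈ ℋ, ∀ i, |h (x i)| ≤ w i)
    (hD : 0 < ∑ i, w i ^ 2) (k : ℕ) :
    ∃ A : Finset (EuclideanSpace ℝ ι),
      (∀ a ∈ A, a ∈ (fun h : Ξ → ℝ => WithLp.toLp 2 fun i => h (x i)) '' ℋ) ∧
      (∀ t ∈ (fun h : Ξ → ℝ => WithLp.toLp 2 fun i => h (x i)) '' ℋ,
        ∃ a ∈ A, ‖t - a‖ ≤ √(∑ i, w i ^ 2) / 2 ^ (k + 1)) ∧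
      2 * (A.card : ℝ) ≤ Real.exp (((1 + 2 * V * (4 * V + 6)) * (k + 1)) ^ 2) := by
  set T : Set (EuclideanSpace ℝ ι) := (fun h : Ξ → ℝ => WithLp.toLp 2 fun i => h (x i)) '' ℋ
    with hT
  -- One function per value vector; off T the value 0 is never used.
  have hsec : ∀ t : EuclideanSpace ℝ ι, ∃ h : Ξ → ℝ, t ∈ T → h ∈ ℋ ∧ ∀ i, h (x i) = t i := by
    intro t
    by_cases ht : t ∈ T
    · obtain ⟨h, hh, rfl⟩ := ht
      exact ⟨h, fun _ => ⟨hh, fun i => rfl⟩⟩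
    · exact ⟨0, fun h => absurd h ht⟩
  choose φ hφ using hsec
  -- Squared distances exceed S / 4 ^ (k + 1), and |a - b|² ≤ 2 w |a - b| in each coordinate, so the
  -- weighted L¹ distance is at least S / (2 · 4 ^ (k + 1)) = δ (2S).
  set δ : ℝ := 1 / 4 ^ (k + 2) with hδ
  have hδ0 : 0 < δ := by positivity
  have hδ1 : δ ≤ 1 := by
    rw [hδ, div_le_one (by positivity)]
    exact one_le_pow₀ (by norm_num)
  have hpack : ∀ A : Finset (EuclideanSpace ℝ ι), (∀ a ∈ A, a ∈ T) →
      (∀ a ∈ A, ∀ b ∈ A, a ≠ b → √(∑ i, w i ^ 2) / 2 ^ (k + 1) < ‖a - b‖) →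
      (A.card : ℝ) ≤ ((4 * V + 2) / δ) ^ (2 * V) := by
    intro A hAT hsep
    rcases A.eq_empty_or_nonempty with rfl | hne
    · simp only [Finset.card_empty, Nat.cast_zero]; positivity
    refine le_pow_of_le_log_pow V (by exact_mod_cast hne.card_pos) hδ0 hδ1 ?_
    refine card_le_log_pow hV x w hw φ A (fun a ha => (hφ a (hAT a ha)).1)
      (fun a ha i => hℋ _ (hφ a (hAT a ha)).1 i) hδ0 hδ1 hD fun a ha b hb hab => ?_
    have h1 := pow_le_pow_left₀ (by positivity) (hsep a ha b hb hab).le 2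
    rw [div_pow, Real.sq_sqrt hD.le, EuclideanSpace.norm_sq_eq] at h1
    have h2 : ∑ i, ‖(a - b) i‖ ^ 2 ≤ ∑ i, 2 * (w i * |φ a (x i) - φ b (x i)|) := by
      refine Finset.sum_le_sum fun i _ => ?_
      have ha' := (hφ a (hAT a ha)).2 i
      have hb' := (hφ b (hAT b hb)).2 i
      have ha2 := hℋ _ (hφ a (hAT a ha)).1 i
      have hb2 := hℋ _ (hφ b (hAT b hb)).1 i
      have h3 : |φ a (x i) - φ b (x i)| ≤ 2 * w i := (abs_sub _ _).trans (by linarith)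
      have h4 : ‖(a - b) i‖ = |φ a (x i) - φ b (x i)| := by
        rw [ha', hb', Real.norm_eq_abs, PiLp.sub_apply]
      rw [h4]
      nlinarith [abs_nonneg (φ a (x i) - φ b (x i))]
    rw [← Finset.mul_sum] at h2
    have h5 : δ * (2 * ∑ i, w i ^ 2) = (∑ i, w i ^ 2) / (2 ^ (k + 1)) ^ 2 / 2 := by
      have h6 : ((2 : ℝ) ^ (k + 1)) ^ 2 = 4 ^ (k + 1) := by
        rw [← pow_mul, mul_comm, pow_mul]; norm_num
      rw [hδ, h6, pow_succ (4 : ℝ) (k + 1)]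
      field_simp
      norm_num
    rw [h5]
    linarith
  obtain ⟨A, hAT, hsep, hnet⟩ := exists_net_of_card_le T (√(∑ i, w i ^ 2) / 2 ^ (k + 1))
    ⌊((4 * V + 2) / δ) ^ (2 * V)⌋₊ fun A h1 h2 => Nat.le_floor (hpack A h1 h2)
  refine ⟨A, hAT, fun t ht => ?_, two_mul_le_exp_of_le_pow V k (hpack A hAT hsep)⟩
  obtain ⟨a, ha, h | rfl⟩ := hnet t ht
  · exact ⟨a, ha, h⟩
  · exact ⟨t, ha, by simp; positivity⟩

/-- The Rademacher average of a VC-subgraph class over fixed points is at most a constant times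
the Euclidean norm of the envelope. -/
theorem exists_majorant_of_shatters_card_le [DecidableEq ι] {ℋ : Set (Ξ → ℝ)} {V : ℕ}
    (hV : ∀ s : Finset (Ξ × ℝ), Shatters (strictSubgraph '' ℋ) s → s.card ≤ V)
    (x : ι → Ξ) (w : ι → ℝ) (hw : ∀ i, 0 ≤ w i) (hℋ : ∀ h ∈ ℋ, ∀ i, |h (x i)| ≤ w i)
    {s : ℝ} (hs : 0 < s) :
    ∃ M : (ι → Bool) → ℝ, (∀ ε, ∀ h ∈ ℋ, |rademacherSum ε fun i => h (x i)| ≤ M ε) ∧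
      ∑ ε, M ε ≤ 2 ^ Fintype.card ι *
        (4 * (1 + 2 * V * (4 * V + 6)) * ((∑ i, w i ^ 2) / s + s)) := by
  set c : ℝ := 1 + 2 * V * (4 * V + 6) with hc
  have hc1 : 1 ≤ c := le_add_of_nonneg_right (by positivity)
  have hS : 0 ≤ ∑ i, w i ^ 2 := by positivity
  rcases hS.eq_or_lt with hD | hD
  · refine ⟨fun _ => 0, fun ε h hh => ?_, by simp; positivity⟩
    have h0 : ∀ i, h (x i) = 0 := by
      intro i
      have h1 := (Finset.sum_eq_zero_iff_of_nonneg (fun i _ => sq_nonneg (w i))).1 hD.symm i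
        (Finset.mem_univ i)
      have h2 := hℋ h hh i
      rw [pow_eq_zero_iff two_ne_zero] at h1
      rw [h1] at h2
      exact abs_nonpos_iff.1 h2
    simp [rademacherSum, h0]
  · choose B hBT hBnet hBcard using exists_net_of_shatters_card_le hV x w hw hℋ hD
    have hD' : 0 < √(∑ i, w i ^ 2) := Real.sqrt_pos.2 hD
    obtain ⟨M, hM, hMs⟩ := exists_majorant_of_nets
      (T := (fun h : Ξ → ℝ => (WithLp.toLp 2 fun i => h (x i) : EuclideanSpace ℝ ι)) '' ℋ)
      -- The nets are shifted by one level: {0} has mesh √S because every value vector has norm at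
      -- most √S.
      (fun k => Nat.casesOn k {0} B) hD' (zero_lt_one.trans_le hc1) rfl (fun k => hBT k)
      (fun k => by
        cases k with
        | zero =>
          rintro t ⟨h, hh, rfl⟩
          refine ⟨0, by simp, ?_⟩
          rw [sub_zero, pow_zero, div_one, EuclideanSpace.norm_eq]
          refine Real.sqrt_le_sqrt (Finset.sum_le_sum fun i _ => ?_)
          exact pow_le_pow_left₀ (norm_nonneg _) (hℋ h hh i) 2
        | succ k => exact hBnet k) hBcard hs
    refine ⟨M, fun ε h hh => hM ε _ ⟨h, hh, rfl⟩, hMs.trans ?_⟩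
    gcongr
    have h1 : 2 * √(∑ i, w i ^ 2) ≤ (∑ i, w i ^ 2) / s + s := by
      rw [div_add' _ _ _ hs.ne', le_div_iff₀ hs]
      nlinarith [sq_nonneg (√(∑ i, w i ^ 2) - s), Real.sq_sqrt hD.le]
    have h2 : s ≤ (∑ i, w i ^ 2) / s + s := le_add_of_nonneg_left (by positivity)
    nlinarith

/-- An infinite envelope value makes the right side infinite; otherwise the real-valued majorant
applies. -/
theorem sum_iSup_rademacherSum_le [DecidableEq ι] {ℋ : Set (Ξ → ℝ)} {V : ℕ}
    (hV : ∀ s : Finset (Ξ × ℝ), Shatters (strictSubgraph '' ℋ) s → s.card ≤ V)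
    {H : Ξ → ℝ≥0∞} (hH : IsEnvelope ℋ H) (x : ι → Ξ) {s : ℝ} (hs : 0 < s) :
    ∑ ε : ι → Bool, ⨆ h ∈ ℋ, ENNReal.ofReal |rademacherSum ε fun i => h (x i)| ≤
      2 ^ Fintype.card ι * (ENNReal.ofReal (4 * (1 + 2 * V * (4 * V + 6))) *
        ((∑ i, H (x i) ^ 2) / ENNReal.ofReal s + ENNReal.ofReal s)) := by
  have hC : (0 : ℝ) < 4 * (1 + 2 * V * (4 * V + 6)) := by positivity
  by_cases htop : ∃ i, H (x i) = ⊤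
  · obtain ⟨i, hi⟩ := htop
    have h1 : ∑ i, H (x i) ^ 2 = ⊤ :=
      ENNReal.sum_eq_top.2 ⟨i, Finset.mem_univ i, by rw [hi]; simp⟩
    rw [h1, ENNReal.top_div_of_ne_top ENNReal.ofReal_ne_top, top_add,
      ENNReal.mul_top (by simpa using hC), ENNReal.mul_top (by simp)]
    exact le_top
  push Not at htop
  obtain ⟨M, hM, hMs⟩ := exists_majorant_of_shatters_card_le hV x (fun i => (H (x i)).toReal)
    (fun i => ENNReal.toReal_nonneg)
    (fun h hh i => (ENNReal.ofReal_le_iff_le_toReal (htop i)).1 (hH h hh (x i))) hs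
  have hle : ∀ ε, (⨆ h ∈ ℋ, ENNReal.ofReal |rademacherSum ε fun i => h (x i)|) ≤
      ENNReal.ofReal (M ε) := fun ε =>
    iSup₂_le fun h hh => ENNReal.ofReal_le_ofReal (hM ε h hh)
  rcases ℋ.eq_empty_or_nonempty with rfl | ⟨h₀, hh₀⟩
  · simp
  have hM0 : ∀ ε, 0 ≤ M ε := fun ε => (abs_nonneg _).trans (hM ε h₀ hh₀)
  calc _ ≤ ∑ ε, ENNReal.ofReal (M ε) := Finset.sum_le_sum fun ε _ => hle ε
    _ = ENNReal.ofReal (∑ ε, M ε) := (ENNReal.ofReal_sum_of_nonneg fun ε _ => hM0 ε).symm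
    _ ≤ _ := ENNReal.ofReal_le_ofReal hMs
    _ = _ := by
        rw [ENNReal.ofReal_mul (by positivity), ENNReal.ofReal_mul hC.le,
          ENNReal.ofReal_add (by positivity) hs.le, ENNReal.ofReal_div_of_pos hs,
          ENNReal.ofReal_sum_of_nonneg (fun i _ => by positivity),
          ENNReal.ofReal_pow (by norm_num)]
        simp [ENNReal.ofReal_pow, ENNReal.ofReal_toReal (htop _)]

end VCRademacher

/-! ### Bounds for outer expectations -/

section OuterBounds

variable {Ω : Type*} [MeasurableSpace Ω] {μ : Measure Ω}

theorem toENNReal_neg_of_nonneg {x : EReal} (hx : 0 ≤ x) : (-x).toENNReal = 0 :=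
  EReal.toENNReal_of_nonpos (by rwa [EReal.neg_le, neg_zero])

theorem expectation_coe_ennreal (V : Ω → ℝ≥0∞) :
    expectation μ (fun ω => (V ω : EReal)) = ((∫⁻ ω, V ω ∂μ : ℝ≥0∞) : EReal) := by
  simp only [expectation, toENNReal_neg_of_nonneg (EReal.coe_ennreal_nonneg _),
    EReal.toENNReal_coe]
  simp

theorem outerExpectation_nonneg (U : Ω → ℝ≥0∞) :
    0 ≤ outerExpectation μ (fun ω => (U ω : EReal)) := by
  refine le_sInf ?_
  rintro e ⟨V, -, hUV, -, rfl⟩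
  have h : ∀ ω, (-(V ω)).toENNReal = 0 := fun ω =>
    toENNReal_neg_of_nonneg ((EReal.coe_ennreal_nonneg (U ω)).trans (hUV ω))
  simp only [expectation, h]
  simpa using EReal.coe_ennreal_nonneg _

theorem outerExpectation_le_lintegral {U V : Ω → ℝ≥0∞} (hV : Measurable V) (hUV : ∀ ω, U ω ≤ V ω) :
    outerExpectation μ (fun ω => (U ω : EReal)) ≤ ((∫⁻ ω, V ω ∂μ : ℝ≥0∞) : EReal) := by
  refine sInf_le ⟨fun ω => (V ω : EReal), hV.coe_ereal_ennreal,
    fun ω => EReal.coe_ennreal_le_coe_ennreal_iff.2 (hUV ω), Or.inr ?_,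
    (expectation_coe_ennreal V).symm⟩
  simp only [toENNReal_neg_of_nonneg (EReal.coe_ennreal_nonneg _)]
  simp

/-- An almost everywhere measurable function has a measurable majorant with the same integral. -/
theorem exists_measurable_ge_lintegral_eq {f : Ω → ℝ≥0∞} (hf : AEMeasurable f μ) :
    ∃ g : Ω → ℝ≥0∞, Measurable g ∧ (∀ ω, f ω ≤ g ω) ∧ ∫⁻ ω, g ω ∂μ = ∫⁻ ω, f ω ∂μ := by
  classical
  set N := toMeasurable μ {ω | f ω ≠ hf.mk f ω} with hN
  have hN0 : μ N = 0 := by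
    rw [hN, measure_toMeasurable]
    exact ae_iff.1 hf.ae_eq_mk
  have hNm : MeasurableSet N := measurableSet_toMeasurable _ _
  -- The value ∞ on a measurable null set gives domination everywhere, as the outer expectation
  -- requires.
  refine ⟨N.piecewise (fun _ => ⊤) (hf.mk f),
    Measurable.piecewise hNm measurable_const hf.measurable_mk, fun ω => ?_, ?_⟩
  · by_cases hω : ω ∈ N
    · simp [hω]
    · have : f ω = hf.mk f ω := by
        by_contra h
        exact hω (subset_toMeasurable _ _ h)
      simp [hω, this.le]
  · refine lintegral_congr_ae ?_
    filter_upwards [hf.ae_eq_mk, measure_eq_zero_iff_ae_notMem.1 hN0] with ω h1 h2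
    simp [h2, h1]

end OuterBounds

/-! ### Symmetrization -/

section Symmetrization

variable {Ξ : Type*} [MeasurableSpace Ξ] {P : Measure Ξ} [IsProbabilityMeasure P]

theorem lintegral_comp_of_measurePreserving {α β : Type*} [MeasurableSpace α] [MeasurableSpace β]
    {μ : Measure α} {ν : Measure β} {g : α → β} (hg : MeasurePreserving g μ ν) {f : β → ℝ≥0∞}
    (hf : AEMeasurable f ν) : ∫⁻ a, f (g a) ∂μ = ∫⁻ b, f b ∂ν := by
  rw [← hg.map_eq, lintegral_map' (by rwa [hg.map_eq]) hg.aemeasurable]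

theorem measurePreserving_pi_comp_equiv {ι ι' : Type*} [Fintype ι] [Fintype ι'] (σ : ι' ≃ ι) :
    MeasurePreserving (fun (x : ι → Ξ) i => x (σ i)) (Measure.pi fun _ => P)
      (Measure.pi fun _ => P) :=
  (measurePreserving_piCongrLeft (fun _ : ι => P) σ).symm

/-- The supremum of `|∑ eᵢ h(xᵢ)|` over the class. -/
def supWeightedSum (ℋ : Set (Ξ → ℝ)) {ι : Type*} [Fintype ι] (e : ι → ℝ) (x : ι → Ξ) : ℝ≥0∞ :=
  ⨆ h ∈ ℋ, ENNReal.ofReal |∑ i, e i * h (x i)|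

theorem supWeightedSum_comp_equiv {Ξ : Type*} (ℋ : Set (Ξ → ℝ)) {ι ι' : Type*} [Fintype ι] [Fintype ι']
    (σ : ι' ≃ ι) (e : ι → ℝ) (x : ι → Ξ) :
    supWeightedSum ℋ (fun i => e (σ i)) (fun i => x (σ i)) = supWeightedSum ℋ e x := by
  unfold supWeightedSum
  congr! 6 with h
  exact σ.sum_comp fun i => e i * h (x i)

variable {ℋ : Set (Ξ → ℝ)}

/-- Relabelling coordinates carries measurability from `Fin n` to any finite index set, in
particular to the doubled set `ι ⊕ ι`. -/
theorem IsPMeasurableClass.aemeasurable (hℋ : IsPMeasurableClass P ℋ) {ι : Type*} [Fintype ι]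
    (e : ι → ℝ) : AEMeasurable (supWeightedSum ℋ e) (Measure.pi fun _ : ι => P) := by
  let σ := Fintype.equivFin ι
  have h1 : AEMeasurable (supWeightedSum ℋ fun i => e (σ.symm i))
      (Measure.pi fun _ : Fin (Fintype.card ι) => P) :=
    NullMeasurable.aemeasurable (hℋ _ _)
  have h2 := h1.comp_quasiMeasurePreserving
    (measurePreserving_pi_comp_equiv (P := P) σ.symm).quasiMeasurePreserving
  refine h2.congr (Eventually.of_forall fun x => ?_)
  exact supWeightedSum_comp_equiv ℋ σ.symm e x

/-- The permutation of two copies of an index set that swaps the copies of `i` when `ε i` is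
`false`. -/
def swapPerm {ι : Type*} (ε : ι → Bool) : Equiv.Perm (ι ⊕ ι) :=
  Function.Involutive.toPerm
    (fun s => if ε (s.elim id id) then s else s.swap) (by
      rintro (i | i) <;> by_cases h : ε i <;> simp [h])

@[simp]
theorem swapPerm_apply {ι : Type*} (ε : ι → Bool) (s : ι ⊕ ι) :
    swapPerm ε s = if ε (s.elim id id) then s else s.swap := rfl

theorem lintegral_supWeightedSum_elim_le (hℋ : IsPMeasurableClass P ℋ) {ι : Type*} [Fintype ι]
    (a : ι → ℝ) :
    ∫⁻ z, supWeightedSum ℋ (Sum.elim a (-a)) z ∂(Measure.pi fun _ : ι ⊕ ι => P) ≤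
      2 * ∫⁻ x, supWeightedSum ℋ a x ∂(Measure.pi fun _ : ι => P) := by
  have hl : MeasurePreserving (fun (z : ι ⊕ ι → Ξ) i => z (Sum.inl i))
      (Measure.pi fun _ => P) (Measure.pi fun _ => P) :=
    measurePreserving_fst.comp (measurePreserving_sumPiEquivProdPi fun _ : ι ⊕ ι => P)
  have hr : MeasurePreserving (fun (z : ι ⊕ ι → Ξ) i => z (Sum.inr i))
      (Measure.pi fun _ => P) (Measure.pi fun _ => P) :=
    measurePreserving_snd.comp (measurePreserving_sumPiEquivProdPi fun _ : ι ⊕ ι => P)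
  have ha := hℋ.aemeasurable a
  calc _ ≤ ∫⁻ z, (supWeightedSum ℋ a (fun i => z (Sum.inl i)) +
        supWeightedSum ℋ a (fun i => z (Sum.inr i))) ∂(Measure.pi fun _ : ι ⊕ ι => P) := by
        refine lintegral_mono fun z => iSup₂_le fun h hh => ?_
        have h1 : ∑ i, Sum.elim a (-a) i * h (z i) =
            ∑ i, a i * h (z (Sum.inl i)) - ∑ i, a i * h (z (Sum.inr i)) := by
          simp [Fintype.sum_sum_type, sub_eq_add_neg]
        rw [h1]
        refine (ENNReal.ofReal_le_ofReal (abs_sub _ _)).trans ?_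
        rw [ENNReal.ofReal_add (abs_nonneg _) (abs_nonneg _)]
        exact add_le_add
          (le_iSup₂ (f := fun h (_ : h ∈ ℋ) => ENNReal.ofReal |∑ i, a i * h (z (Sum.inl i))|) h hh)
          (le_iSup₂ (f := fun h (_ : h ∈ ℋ) => ENNReal.ofReal |∑ i, a i * h (z (Sum.inr i))|) h hh)
    _ = _ := by
        have hal : AEMeasurable (fun z : ι ⊕ ι → Ξ => supWeightedSum ℋ a fun i => z (Sum.inl i))
            (Measure.pi fun _ => P) := ha.comp_quasiMeasurePreserving hl.quasiMeasurePreserving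
        rw [lintegral_add_left' hal,
          lintegral_comp_of_measurePreserving hl ha, lintegral_comp_of_measurePreserving hr ha,
          two_mul]

/-- Symmetrization: the integral of the two-sample supremum is at most twice the averaged
Rademacher supremum. -/
theorem pow_mul_lintegral_supWeightedSum_le (hℋ : IsPMeasurableClass P ℋ) {ι : Type*} [Fintype ι]
    [DecidableEq ι] :
    2 ^ Fintype.card ι *
        ∫⁻ z, supWeightedSum ℋ (Sum.elim 1 (-1)) z ∂(Measure.pi fun _ : ι ⊕ ι => P) ≤
      2 * ∫⁻ x, ∑ ε : ι → Bool, supWeightedSum ℋ (fun i => boolSign (ε i)) x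
        ∂(Measure.pi fun _ : ι => P) := by
  have h1 : ∀ ε : ι → Bool,
      ∫⁻ z, supWeightedSum ℋ (Sum.elim 1 (-1)) z ∂(Measure.pi fun _ : ι ⊕ ι => P) ≤
        2 * ∫⁻ x, supWeightedSum ℋ (fun i => boolSign (ε i)) x ∂(Measure.pi fun _ : ι => P) := by
    intro ε
    refine le_trans (le_of_eq ?_)
      (lintegral_supWeightedSum_elim_le hℋ fun i => boolSign (ε i))
    -- Swapping the two copies of i flips the sign of their difference and preserves the law, so
    -- every ε gives the same integral.
    rw [← lintegral_comp_of_measurePreserving (measurePreserving_pi_comp_equiv (swapPerm ε))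
      (hℋ.aemeasurable _)]
    refine lintegral_congr fun z => ?_
    rw [← supWeightedSum_comp_equiv ℋ (swapPerm ε) _ z]
    congr 1
    funext s
    rcases s with i | i <;> by_cases h : ε i <;> simp [boolSign, h]
  rw [lintegral_finsetSum' _ fun ε _ => hℋ.aemeasurable _, Finset.mul_sum]
  calc _ = ∑ _ε : ι → Bool,
        ∫⁻ z, supWeightedSum ℋ (Sum.elim 1 (-1)) z ∂(Measure.pi fun _ : ι ⊕ ι => P) := by simp
    _ ≤ _ := Finset.sum_le_sum fun ε _ => h1 ε

theorem lintegral_supWeightedSum_elim_le_sqrt (hℋ : IsPMeasurableClass P ℋ) {V : ℕ}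
    (hV : ∀ s : Finset (Ξ × ℝ), Shatters (strictSubgraph '' ℋ) s → s.card ≤ V)
    {H : Ξ → ℝ≥0∞} (hHm : Measurable H) (hH : IsEnvelope ℋ H) {n : ℕ} (hn : 1 ≤ n) :
    ∫⁻ z, supWeightedSum ℋ (Sum.elim 1 (-1)) z ∂(Measure.pi fun _ : Fin n ⊕ Fin n => P) ≤
      2 * (ENNReal.ofReal (4 * (1 + 2 * V * (4 * V + 6))) *
        ((∫⁻ x, H x ^ 2 ∂P + 1) * ENNReal.ofReal √n)) := by
  have hs : (0 : ℝ) < √n := Real.sqrt_pos.2 (by exact_mod_cast hn)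
  set C : ℝ≥0∞ := ENNReal.ofReal (4 * (1 + 2 * V * (4 * V + 6)))
  have h2 : (2 : ℝ≥0∞) ^ n ≠ 0 := by positivity
  have h2' : (2 : ℝ≥0∞) ^ n ≠ ⊤ := by simp
  rw [← ENNReal.mul_le_mul_iff_right h2 h2']
  have h0 := pow_mul_lintegral_supWeightedSum_le (P := P) hℋ (ι := Fin n)
  rw [Fintype.card_fin] at h0
  refine h0.trans ?_
  have hpt : ∀ x : Fin n → Ξ, ∑ ε : Fin n → Bool, supWeightedSum ℋ (fun i => boolSign (ε i)) x ≤
      2 ^ n * (C * ((∑ i, H (x i) ^ 2) / ENNReal.ofReal √n + ENNReal.ofReal √n)) := by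
    intro x
    have := sum_iSup_rademacherSum_le hV hH x hs
    rwa [Fintype.card_fin] at this
  have hint : ∫⁻ x : Fin n → Ξ, ∑ i, H (x i) ^ 2 ∂(Measure.pi fun _ => P) =
      n * ∫⁻ x, H x ^ 2 ∂P := by
    rw [lintegral_finsetSum _ fun i _ => by fun_prop]
    have : ∀ i : Fin n, ∫⁻ x : Fin n → Ξ, H (x i) ^ 2 ∂(Measure.pi fun _ => P) =
        ∫⁻ x, H x ^ 2 ∂P := fun i =>
      (measurePreserving_eval (fun _ : Fin n => P) i).lintegral_comp (f := fun y => H y ^ 2)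
        (by fun_prop)
    simp [this]
  have hdiv : (n : ℝ≥0∞) / ENNReal.ofReal √n = ENNReal.ofReal √n := by
    rw [← ENNReal.ofReal_natCast, ← ENNReal.ofReal_div_of_pos hs, Real.div_sqrt]
  calc 2 * ∫⁻ x, ∑ ε : Fin n → Bool, supWeightedSum ℋ (fun i => boolSign (ε i)) x
        ∂(Measure.pi fun _ : Fin n => P)
      ≤ 2 * ∫⁻ x : Fin n → Ξ, 2 ^ n * (C * ((∑ i, H (x i) ^ 2) / ENNReal.ofReal √n +
          ENNReal.ofReal √n)) ∂(Measure.pi fun _ => P) := by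
        gcongr with x
        exact hpt x
    _ = 2 * (2 ^ n * (C * ((n * ∫⁻ x, H x ^ 2 ∂P) / ENNReal.ofReal √n + ENNReal.ofReal √n))) := by
        rw [lintegral_const_mul _ (by fun_prop), lintegral_const_mul _ (by fun_prop),
          lintegral_add_right _ measurable_const, lintegral_const, measure_univ, mul_one]
        simp only [div_eq_mul_inv]
        rw [lintegral_mul_const _ (by fun_prop), hint]
    _ = 2 ^ n * (2 * (C * ((∫⁻ x, H x ^ 2 ∂P + 1) * ENNReal.ofReal √n))) := by
        rw [mul_comm (n : ℝ≥0∞), mul_div_assoc, hdiv, add_mul, one_mul]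
        ring

/-- The centred sum is the mean of the two-sample difference over an independent copy y. -/
theorem ofReal_abs_sum_sub_le {h : Ξ → ℝ} (hh : Integrable h P) {n : ℕ} (x : Fin n → Ξ) :
    ENNReal.ofReal |∑ i, h (x i) - n * ∫ y, h y ∂P| ≤
      ∫⁻ y : Fin n → Ξ, ENNReal.ofReal |∑ i, h (x i) - ∑ i, h (y i)|
        ∂(Measure.pi fun _ => P) := by
  have hi : ∀ i : Fin n, Integrable (fun y : Fin n → Ξ => h (y i)) (Measure.pi fun _ => P) :=
    fun i => (measurePreserving_eval (fun _ : Fin n => P) i).integrable_comp_of_integrable hh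
  have h1 : ∫ y : Fin n → Ξ, (∑ i, h (x i) - ∑ i, h (y i)) ∂(Measure.pi fun _ => P) =
      ∑ i, h (x i) - n * ∫ y, h y ∂P := by
    rw [integral_sub (integrable_const _) (integrable_finsetSum _ fun i _ => hi i),
      integral_finsetSum _ fun i _ => hi i]
    have : ∀ i : Fin n, ∫ y : Fin n → Ξ, h (y i) ∂(Measure.pi fun _ => P) = ∫ y, h y ∂P :=
      fun i => integral_comp_eval (μ := fun _ : Fin n => P) (i := i) hh.aestronglyMeasurable
    simp [this]
  rw [← h1]
  simp only [← Real.enorm_eq_ofReal_abs]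
  exact enorm_integral_le_lintegral_enorm _

/-- A measurable majorant of the uniform deviation whose integral is controlled by the two-sample
supremum. -/
theorem exists_measurable_ge_sum_sub (hℋ : IsPMeasurableClass P ℋ)
    (hint : ∀ h ∈ ℋ, Integrable h P) (n : ℕ) :
    ∃ W : (Fin n → Ξ) → ℝ≥0∞, Measurable W ∧
      (∀ h ∈ ℋ, ∀ x, ENNReal.ofReal |∑ i, h (x i) - n * ∫ y, h y ∂P| ≤ W x) ∧
      ∫⁻ x, W x ∂(Measure.pi fun _ => P) =
        ∫⁻ z, supWeightedSum ℋ (Sum.elim 1 (-1)) z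
          ∂(Measure.pi fun _ : Fin n ⊕ Fin n => P) := by
  have hmp := measurePreserving_sumPiEquivProdPi_symm fun _ : Fin n ⊕ Fin n => P
  have hG := hℋ.aemeasurable (Sum.elim 1 (-1) : Fin n ⊕ Fin n → ℝ)
  -- Measurability for the completion does not pass to every section; a measurable majorant g makes
  -- the partial integral over y measurable in x.
  obtain ⟨g, hgm, hgle, hg⟩ := exists_measurable_ge_lintegral_eq
    (hG.comp_quasiMeasurePreserving hmp.quasiMeasurePreserving)
  refine ⟨fun x => ∫⁻ y, g (x, y) ∂(Measure.pi fun _ => P), hgm.lintegral_prod_right',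
    fun h hh x => (ofReal_abs_sum_sub_le (hint h hh) x).trans (lintegral_mono fun y => ?_), ?_⟩
  · refine le_trans ?_ (hgle (x, y))
    refine le_trans (le_of_eq ?_)
      (le_iSup₂ (f := fun h (_ : h ∈ ℋ) => ENNReal.ofReal |∑ i, (Sum.elim 1 (-1) :
        Fin n ⊕ Fin n → ℝ) i * h ((MeasurableEquiv.sumPiEquivProdPi fun _ => Ξ).symm (x, y) i)|)
        h hh)
    simp [Fintype.sum_sum_type, sub_eq_add_neg, MeasurableEquiv.coe_sumPiEquivProdPi_symm]
  · rw [← lintegral_prod _ hgm.aemeasurable, hg]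
    exact lintegral_comp_of_measurePreserving hmp hG

theorem uniformDeviation_le {P : Measure Ξ} (hmeas : ∀ h ∈ ℋ, Measurable h) {n : ℕ} (hn : 1 ≤ n)
    {W : (Fin n → Ξ) → ℝ≥0∞}
    (hW : ∀ h ∈ ℋ, ∀ x, ENNReal.ofReal |∑ i, h (x i) - n * ∫ y, h y ∂P| ≤ W x) (x : ℕ → Ξ) :
    uniformDeviation P ℋ x n ≤ (n : ℝ≥0∞)⁻¹ * W fun i => x i := by
  have hn' : (0 : ℝ) < n := by exact_mod_cast hn
  refine iSup₂_le fun h hh => ?_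
  rw [integral_empiricalMeasure x n (hmeas h hh)]
  have h1 : (n : ℝ)⁻¹ * ∑ i ∈ Finset.range n, h (x i) - ∫ y, h y ∂P =
      (n : ℝ)⁻¹ * (∑ i : Fin n, h (x i) - n * ∫ y, h y ∂P) := by
    rw [← Fin.sum_univ_eq_sum_range fun i => h (x i)]
    field_simp
  rw [h1, abs_mul, abs_of_pos (inv_pos.2 hn'), ENNReal.ofReal_mul (inv_pos.2 hn').le,
    ENNReal.ofReal_inv_of_pos hn', ENNReal.ofReal_natCast]
  gcongr
  exact hW h hh _

theorem IsEnvelope.integrable {H : Ξ → ℝ≥0∞} (hH : IsEnvelope ℋ H)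
    (hmeas : ∀ h ∈ ℋ, Measurable h) (hH2 : ∫⁻ x, H x ^ 2 ∂P < ⊤) :
    ∀ h ∈ ℋ, Integrable h P := by
  intro h hh
  refine ⟨(hmeas h hh).aestronglyMeasurable, ?_⟩
  calc ∫⁻ x, ‖h x‖ₑ ∂P ≤ ∫⁻ x, (H x ^ 2 + 1) ∂P := by
        refine lintegral_mono fun x => ?_
        rw [Real.enorm_eq_ofReal_abs]
        refine (hH h hh x).trans ?_
        rcases le_total (H x) 1 with h1 | h1
        · exact h1.trans le_add_self
        · exact (le_self_pow₀ h1 two_ne_zero).trans le_self_add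
    _ = ∫⁻ x, H x ^ 2 ∂P + 1 := by rw [lintegral_add_right _ measurable_const]; simp
    _ < ⊤ := ENNReal.add_lt_top.2 ⟨hH2, ENNReal.one_lt_top⟩

/-- The maximal inequality behind the main theorem, with an explicit constant. -/
theorem outerExpectation_uniformDeviation_le {Ω : Type*} [MeasurableSpace Ω] {μ : Measure Ω}
    [IsProbabilityMeasure μ] {ξ : ℕ → Ω → Ξ} (hξ_meas : ∀ i, Measurable (ξ i))
    (hξ_indep : iIndepFun ξ μ) (hξ_law : ∀ i, μ.map (ξ i) = P)
    (hmeas : ∀ h ∈ ℋ, Measurable h) {V : ℕ}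
    (hV : ∀ s : Finset (Ξ × ℝ), Shatters (strictSubgraph '' ℋ) s → s.card ≤ V)
    {H : Ξ → ℝ≥0∞} (hHm : Measurable H) (hH : IsEnvelope ℋ H) (hH2 : ∫⁻ x, H x ^ 2 ∂P < ⊤)
    (hℋ : IsPMeasurableClass P ℋ) {n : ℕ} (hn : 1 ≤ n) :
    outerExpectation μ (fun ω => (uniformDeviation P ℋ (fun i => ξ i ω) n : EReal)) ≤
      ((8 * (1 + 2 * V * (4 * V + 6)) * ((∫⁻ x, H x ^ 2 ∂P).toReal + 1) *
        (n : ℝ) ^ (-(1 / 2) : ℝ) : ℝ) : EReal) := by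
  have hn' : (0 : ℝ) < n := by exact_mod_cast hn
  obtain ⟨W, hWm, hW, hWint⟩ :=
    exists_measurable_ge_sum_sub hℋ (hH.integrable hmeas hH2) n
  have hξn : Measurable fun ω (i : Fin n) => ξ i ω := measurable_pi_lambda _ fun i => hξ_meas i
  have hlaw : μ.map (fun ω (i : Fin n) => ξ i ω) = Measure.pi fun _ : Fin n => P := by
    have h1 := (iIndepFun_iff_map_fun_eq_pi_map (f := fun (i : Fin n) => ξ i)
      fun i => (hξ_meas i).aemeasurable).1 (hξ_indep.precomp Fin.val_injective)
    simpa [hξ_law] using h1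
  have hWξ : Measurable fun ω => W (fun i : Fin n => ξ i ω) := hWm.comp hξn
  refine (outerExpectation_le_lintegral (μ := μ) (hWξ.const_mul (n : ℝ≥0∞)⁻¹)
    fun ω => uniformDeviation_le hmeas hn hW fun i => ξ i ω).trans ?_
  rw [lintegral_const_mul _ hWξ, ← lintegral_map hWm hξn, hlaw, hWint]
  set K := (∫⁻ x, H x ^ 2 ∂P).toReal with hK
  have hK0 : 0 ≤ K := ENNReal.toReal_nonneg
  have hKe : ∫⁻ x, H x ^ 2 ∂P = ENNReal.ofReal K := (ENNReal.ofReal_toReal hH2.ne).symm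
  have hroot : (n : ℝ) ^ (-(1 / 2) : ℝ) = (n : ℝ)⁻¹ * √n := by
    rw [Real.rpow_neg hn'.le, ← Real.sqrt_eq_rpow, inv_mul_eq_div, Real.sqrt_div_self']
    simp
  set B : ℝ := 8 * (1 + 2 * V * (4 * V + 6)) * (K + 1) * (n : ℝ) ^ (-(1 / 2) : ℝ) with hB
  have hB0 : 0 ≤ B := by positivity
  have hBe : (n : ℝ≥0∞)⁻¹ * (2 * (ENNReal.ofReal (4 * (1 + 2 * V * (4 * V + 6))) *
      ((∫⁻ x, H x ^ 2 ∂P + 1) * ENNReal.ofReal √n))) = ENNReal.ofReal B := by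
    rw [hKe, ← ENNReal.ofReal_one, ← ENNReal.ofReal_add hK0 zero_le_one,
      ← ENNReal.ofReal_mul (by positivity), ← ENNReal.ofReal_mul (by positivity),
      ← ENNReal.ofReal_ofNat 2, ← ENNReal.ofReal_mul (by positivity), ← ENNReal.ofReal_natCast n,
      ← ENNReal.ofReal_inv_of_pos hn', ← ENNReal.ofReal_mul (by positivity), hB, hroot]
    congr 1
    ring
  calc _ ≤ ((ENNReal.ofReal B : ℝ≥0∞) : EReal) := by
        rw [EReal.coe_ennreal_le_coe_ennreal_iff, ← hBe]
        gcongr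
        exact lintegral_supWeightedSum_elim_le_sqrt hℋ hV hHm hH hn
    _ = (B : EReal) := by rw [EReal.coe_ennreal_ofReal, max_eq_left hB0]

end Symmetrization

end EmpiricalProcess

end

theorem mainTheorem8 {Ω Ξ : Type*} [MeasurableSpace Ω] [MeasurableSpace Ξ]
    (μ : Measure Ω) [IsProbabilityMeasure μ] (P : Measure Ξ) [IsProbabilityMeasure P]
    -- an i.i.d. sequence with law `P`
    (ξ : ℕ → Ω → Ξ) (hξ_meas : ∀ i, Measurable (ξ i))
    (hξ_indep : iIndepFun ξ μ) (hξ_law : ∀ i, μ.map (ξ i) = P)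
    -- a `P`-measurable VC-subgraph class of measurable functions with an envelope in `L₂(P)`
    (ℋ : Set (Ξ → ℝ)) (hℋ_meas : ∀ h ∈ ℋ, Measurable h)
    (hℋ_VC : EmpiricalProcess.IsVCSubgraph ℋ)
    (H : Ξ → ℝ≥0∞) (hH_meas : Measurable H) (hH_env : EmpiricalProcess.IsEnvelope ℋ H)
    (hH_L2 : ∫⁻ x, H x ^ 2 ∂P < ⊤)
    (hℋ_Pmeas : EmpiricalProcess.IsPMeasurableClass P ℋ) :
    (∀ n : ℕ, 1 ≤ n →
      EmpiricalProcess.outerExpectation μ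
          (fun ω => (EmpiricalProcess.uniformDeviation P ℋ (fun i => ξ i ω) n : EReal)) ≠ ⊥ ∧
      EmpiricalProcess.outerExpectation μ
          (fun ω => (EmpiricalProcess.uniformDeviation P ℋ (fun i => ξ i ω) n : EReal)) ≠ ⊤) ∧
    (fun n : ℕ => (EmpiricalProcess.outerExpectation μ
          (fun ω => (EmpiricalProcess.uniformDeviation P ℋ (fun i => ξ i ω) n : EReal))).toReal)
      =O[atTop] (fun n : ℕ => (n : ℝ) ^ (-(1 / 2) : ℝ)) := by
  obtain ⟨V, hV⟩ := EmpiricalProcess.card_le_of_isVCSubgraph hℋ_VC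
  have hle : ∀ n : ℕ, 1 ≤ n → _ := fun n hn =>
    EmpiricalProcess.outerExpectation_uniformDeviation_le hξ_meas hξ_indep hξ_law hℋ_meas hV
      hH_meas hH_env hH_L2 hℋ_Pmeas hn
  have hge : ∀ n : ℕ, 0 ≤ EmpiricalProcess.outerExpectation μ (fun ω =>
      (EmpiricalProcess.uniformDeviation P ℋ (fun i => ξ i ω) n : EReal)) := fun n =>
    EmpiricalProcess.outerExpectation_nonneg _
  refine ⟨fun n hn => ⟨fun h => ?_, ne_top_of_le_ne_top (EReal.coe_ne_top _) (hle n hn)⟩, ?_⟩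
  · exact absurd (h ▸ hge n) (by simp)
  · refine IsBigO.of_bound (8 * (1 + 2 * V * (4 * V + 6)) * ((∫⁻ x, H x ^ 2 ∂P).toReal + 1)) ?_
    filter_upwards [eventually_ge_atTop 1] with n hn
    rw [Real.norm_of_nonneg (EReal.toReal_nonneg (hge n)), Real.norm_of_nonneg (by positivity)]
    exact EReal.toReal_le_toReal (hle n hn) (fun h => absurd (h ▸ hge n) (by simp))
      (EReal.coe_ne_top _)
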